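/- Let $\tau(n)$, $n\ge 1$, be Ramanujan's tau function, defined by $$\Delta(z)=q\prod_{k\ge 1}(1-q^k)^{24}=\sum_{n\ge 1}\tau(n)q^n,\qquad q=e^{2\pi i z},\ \operatorname{Im} z>0,$$ and let $\sigma_k(n)=\sum_{d\mid n}d^k$ and $\sigma(n)=\sigma_1(n)$. Then for every integer $n\ge 1$, $$\tau(n)=50\,n^4\sigma_3(n)-7\,n^4(12n-5)\,\sigma(n)-840\sum_{m=1}^{n-1}m^4\,\sigma(m)\,\sigma(n-m),$$ where the sum is empty (equal to $0$) for $n=1$. -/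

import Mathlib

open scoped ArithmeticFunction.sigma

/-- Ramanujan's tau function: `τ(n)` is the coefficient of `q ^ n`, `q = exp (2 * π * i * z)`, in
the `q`-expansion of the modular discriminant `Δ(z) = η(z) ^ 24 = q * ∏_{n ≥ 1} (1 - q ^ n) ^ 24`
on the upper half-plane. -/
noncomputable def ramanujanTau (n : ℕ) : ℂ :=
  (UpperHalfPlane.qExpansion 1 ModularForm.discriminant).coeff n

/-- The defining expansion `q * ∏_{k ≥ 1} (1 - q ^ k) ^ 24 = ∑ τ(n) * q ^ n`. -/
theorem hasSum_ramanujanTau (z : UpperHalfPlane) :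
    HasSum (fun n : ℕ => ramanujanTau n * Complex.exp (2 * Real.pi * Complex.I * z) ^ n)
      (Complex.exp (2 * Real.pi * Complex.I * z) *
        ∏' k : ℕ, (1 - Complex.exp (2 * Real.pi * Complex.I * z) ^ (k + 1)) ^ 24) := by
  have h := ModularForm.hasSum_qExpansion (f := CuspForm.discriminant) (h := 1) one_pos
    one_mem_strictPeriods_SL z
  have hp := ModularForm.discriminant_eq_q_prod z
  simp only [CuspForm.coe_discriminant, hp] at h
  simpa [ramanujanTau, ModularForm.eta_q, Function.Periodic.qParam] using h

open UpperHalfPlane hiding I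
open Complex Derivative ModularForm EisensteinSeries MatrixGroups PowerSeries Manifold

/-! Write θ = q d/dq. Ramanujan's equations make ℂ[E₂, E₄, E₆] closed under θ, so θ⁴E₄, θ⁵E₂ and
E₂·θ⁴E₂ are polynomials of weight 12 in E₂, E₄, E₆. In a suitable linear combination every monomial
containing E₂ cancels, leaving a multiple of E₄³ - E₆² = 1728Δ (`ramanujan_derivation_identity`,
with 12θ to clear denominators). Comparing coefficients of qⁿ gives the formula: the three terms
yield n⁴σ₃(n), n⁵σ(n) and the convolution sum, the last also giving n⁴σ(n) through the constant term
of E₂.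

Ramanujan's equations hold because the Serre derivatives of E₂, E₄, E₆ (of weight 1, 4, 6) are level
one forms of weight 4, 6, 8, and such forms are determined by their constant terms. -/

/-- A holomorphic function on the upper half-plane, invariant under `z ↦ z + 1` and bounded at
`i∞`: these are the functions with a convergent `q`-expansion. -/
structure IsHolomorphicPeriodic (f : ℍ → ℂ) : Prop where
  periodic : Function.Periodic (f ∘ ofComplex) (1 : ℝ)
  mdifferentiable : MDiff f
  bounded : IsBoundedAtImInfty f

/-! ### Holomorphic periodic functions and their q-expansions -/

namespace IsHolomorphicPeriodic

variable {f g : ℍ → ℂ}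

lemma analyticAt (hf : IsHolomorphicPeriodic f) : AnalyticAt ℂ (cuspFunction 1 f) 0 :=
  analyticAt_cuspFunction_zero one_pos hf.periodic hf.mdifferentiable hf.bounded

lemma coeff_qExpansion_eq (hf : IsHolomorphicPeriodic f) {c : ℕ → ℂ}
    (hc : ∀ τ : ℍ, HasSum (fun m : ℕ ↦ c m • Function.Periodic.qParam 1 τ ^ m) (f τ)) (m : ℕ) :
    (qExpansion 1 f).coeff m = c m := by
  have h1 := (hasFPowerSeriesOnBall_cuspFunction one_pos hf.analyticAt hc).hasFPowerSeriesAt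
  have h2 := (hasFPowerSeriesOnBall_cuspFunction one_pos hf.analyticAt
    (hasSum_qExpansion one_pos hf.periodic hf.mdifferentiable hf.bounded)).hasFPowerSeriesAt
  simpa using congr_arg (FormalMultilinearSeries.coeff · m) (h2.eq_formalMultilinearSeries h1)

lemma mul (hf : IsHolomorphicPeriodic f) (hg : IsHolomorphicPeriodic g) :
    IsHolomorphicPeriodic (f * g) where
  periodic := hf.periodic.mul hg.periodic
  mdifferentiable := hf.mdifferentiable.mul hg.mdifferentiable
  bounded := hf.bounded.mul hg.bounded

lemma sub (hf : IsHolomorphicPeriodic f) (hg : IsHolomorphicPeriodic g) :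
    IsHolomorphicPeriodic (f - g) where
  periodic := hf.periodic.sub hg.periodic
  mdifferentiable := hf.mdifferentiable.sub hg.mdifferentiable
  bounded := hf.bounded.sub hg.bounded

lemma smul (c : ℂ) (hf : IsHolomorphicPeriodic f) : IsHolomorphicPeriodic (c • f) where
  periodic := hf.periodic.smul c
  mdifferentiable := hf.mdifferentiable.const_smul c
  bounded := hf.bounded.const_smul_left c

/-- By the chain rule, if f(τ) = F(q) then (2πi)⁻¹ df/dτ = q F'(q), and F' has its Taylor series on
the whole unit disc. -/
lemma hasSum_normalizedDeriv (hf : IsHolomorphicPeriodic f) (τ : ℍ) :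
    HasSum (fun m : ℕ ↦ (m * (qExpansion 1 f).coeff m) • Function.Periodic.qParam 1 τ ^ m)
      (normalizedDerivOfComplex f τ) := by
  have hq : ‖Function.Periodic.qParam 1 (τ : ℂ)‖ < 1 :=
    Function.Periodic.norm_qParam_lt_one one_pos τ.im_pos
  have hdiff := differentiableOn_cuspFunction_ball one_pos hf.periodic hf.mdifferentiable hf.bounded
  have hcomp : f ∘ ofComplex = cuspFunction 1 f ∘ Function.Periodic.qParam 1 := by
    ext z
    exact (Function.Periodic.eq_cuspFunction one_ne_zero hf.periodic z).symm
  have hqd : HasDerivAt (Function.Periodic.qParam 1)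
      (2 * Real.pi * I * Function.Periodic.qParam 1 (τ : ℂ)) (τ : ℂ) := by
    have h := ((hasDerivAt_id (τ : ℂ)).const_mul (2 * Real.pi * I)).cexp
    refine (h.congr_deriv ?_).congr_of_eventuallyEq (.of_forall fun z ↦ ?_) <;>
      simp [Function.Periodic.qParam, mul_comm]
  have hderiv : normalizedDerivOfComplex f τ = Function.Periodic.qParam 1 (τ : ℂ) *
      deriv (cuspFunction 1 f) (Function.Periodic.qParam 1 (τ : ℂ)) := by
    have hd := ((hdiff.differentiableAt (Metric.isOpen_ball.mem_nhds
      (by simpa using hq))).hasDerivAt.comp (τ : ℂ) hqd).deriv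
    rw [normalizedDerivOfComplex, hcomp, hd]
    field_simp [two_pi_I_ne_zero]
  have hT := (hasSum_taylorSeries_on_ball (hdiff.deriv Metric.isOpen_ball)
    (show Function.Periodic.qParam 1 (τ : ℂ) ∈ Metric.ball (0 : ℂ) 1 by simpa using hq)).mul_left
      (Function.Periodic.qParam 1 (τ : ℂ))
  -- The term m = 0 vanishes; dropping it aligns the series with q times the Taylor series of F'.
  rw [hderiv, ← hasSum_nat_add_iff' 1]
  convert! hT using 1
  · ext m
    rw [qExpansion_coeff, iteratedDeriv_succ', Nat.factorial_succ]
    simp only [smul_eq_mul, sub_zero]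
    push_cast
    have : (m + 1 : ℂ) ≠ 0 := by exact_mod_cast m.succ_ne_zero
    field_simp
    ring
  · simp

lemma normalizedDeriv (hf : IsHolomorphicPeriodic f) :
    IsHolomorphicPeriodic (normalizedDerivOfComplex f) where
  periodic w := by
    by_cases! hw : 0 < im w
    · have : 0 < im (w + (1 : ℝ)) := by simpa using hw
      simp only [Function.comp_apply, ofComplex_apply_of_im_pos this, ofComplex_apply_of_im_pos hw,
        normalizedDerivOfComplex]
      rw [← deriv_comp_add_const, show (fun x ↦ (f ∘ ofComplex) (x + (1 : ℝ))) = f ∘ ofComplex from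
        funext hf.periodic]
    -- Off the upper half-plane `ofComplex` is constant, so periodicity is trivial there.
    · have : im (w + (1 : ℝ)) ≤ 0 := by simpa using hw
      rw [Function.comp_apply, Function.comp_apply, ofComplex_apply_of_im_nonpos this,
        ofComplex_apply_of_im_nonpos hw]
  mdifferentiable := normalizedDerivOfComplex_mdifferentiable hf.mdifferentiable
  bounded := isBoundedAtImInfty_of_hasSum_qExpansion one_pos hf.hasSum_normalizedDeriv

lemma coeff_qExpansion_normalizedDeriv (hf : IsHolomorphicPeriodic f) (m : ℕ) :
    (qExpansion 1 (normalizedDerivOfComplex f)).coeff m = m * (qExpansion 1 f).coeff m :=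
  hf.normalizedDeriv.coeff_qExpansion_eq hf.hasSum_normalizedDeriv m

lemma qExpansion_normalizedDeriv (hf : IsHolomorphicPeriodic f) :
    qExpansion 1 (normalizedDerivOfComplex f) =
      ((X : ℂ⟦X⟧) • PowerSeries.derivative ℂ) (qExpansion 1 f) := by
  ext m
  rw [hf.coeff_qExpansion_normalizedDeriv, Derivation.smul_apply, smul_eq_mul]
  cases m <;> simp [coeff_succ_X_mul, coeff_derivative, mul_comm]

lemma of_modularForm {k : ℤ} (F : ModularForm 𝒮ℒ k) : IsHolomorphicPeriodic F where
  periodic := SlashInvariantFormClass.periodic_comp_ofComplex F one_mem_strictPeriods_SL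
  mdifferentiable := ModularFormClass.holo F
  bounded := ModularFormClass.bdd_at_infty F

lemma of_E2 : IsHolomorphicPeriodic E2 where
  periodic w := by
    -- The correction term `D2` vanishes at the translation T, so E₂ is genuinely invariant under
    -- it.
    have h := E2_slash_action ModularGroup.T
    rw [D2_T, smul_zero, sub_zero] at h
    by_cases! hw : 0 < im w
    · have : 0 < im (w + (1 : ℝ)) := by simpa using hw
      simp only [Function.comp_apply, ofComplex_apply_of_im_pos this, ofComplex_apply_of_im_pos hw]
      have h1 := congrFun h ⟨w, hw⟩
      rw [SL_slash_apply, UpperHalfPlane.modular_T_smul] at h1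
      rw [← h1]
      have hd : denom ModularGroup.T (⟨w, hw⟩ : ℍ) = 1 := by
        rw [ModularGroup.denom_apply]
        simp [ModularGroup.T]
      rw [hd, one_zpow, mul_one]
      congr 1
      apply UpperHalfPlane.ext
      simp [add_comm]
    · have : im (w + (1 : ℝ)) ≤ 0 := by simpa using hw
      rw [Function.comp_apply, Function.comp_apply, ofComplex_apply_of_im_nonpos this,
        ofComplex_apply_of_im_nonpos hw]
  mdifferentiable := E2_mdifferentiable
  bounded := isBoundedAtImInfty_E2

lemma serreDerivative (hf : IsHolomorphicPeriodic f) (k : ℂ) :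
    IsHolomorphicPeriodic (Derivative.serreDerivative k f) := by
  have : Derivative.serreDerivative k f =
      normalizedDerivOfComplex f - (k * 12⁻¹) • (E2 * f) := by
    ext z; simp [mul_assoc]
  exact this ▸ hf.normalizedDeriv.sub ((of_E2.mul hf).smul _)

end IsHolomorphicPeriodic

lemma coeff_qExpansion_E2 (m : ℕ) :
    (qExpansion 1 E2).coeff m = if m = 0 then 1 else -24 * (σ 1 m : ℂ) :=
  IsHolomorphicPeriodic.of_E2.coeff_qExpansion_eq (fun τ ↦ by
    simpa only [Function.Periodic.qParam, ofReal_one, div_one]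
      using hasSum_qExpansion_E2 (z := τ)) m

/-! ### Level one forms of small weight -/

/-- A holomorphic function that is bounded at `i∞` and invariant under the weight `k` action of
`SL(2, ℤ)` is a modular form of level one. -/
def levelOneForm (k : ℤ) (f : ℍ → ℂ) (hf : MDiff f) (hb : IsBoundedAtImInfty f)
    (hs : ∀ γ : SL(2, ℤ), f ∣[k] γ = f) : ModularForm 𝒮ℒ k where
  toFun := f
  slash_action_eq' A hA := by
    obtain ⟨A, rfl⟩ := hA
    exact hs A
  holo' := hf
  bdd_at_cusps' hc := by
    rw [Subgroup.IsArithmetic.isCusp_iff_isCusp_SL2Z] at hc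
    rw [OnePoint.isBoundedAt_iff_forall_SL2Z hc]
    intro γ _
    rwa [hs γ]

/-- A level one modular form of weight less than `12` is determined by its constant coefficient. -/
lemma levelOne_eq_of_coeff_zero_eq {k : ℤ} (hk : k < 12) {f g : ℍ → ℂ} (F G : ModularForm 𝒮ℒ k)
    (hF : F = f) (hG : G = g) (h : (qExpansion 1 f).coeff 0 = (qExpansion 1 g).coeff 0) :
    f = g := by
  subst hF hG
  refine congrArg DFunLike.coe (sub_eq_zero.mp (sturm_bound_levelOne (f := F - G) ?_))
  -- The Sturm bound is 0, so vanishing of the constant coefficient suffices.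
  rw [show k.toNat / 12 = 0 by lia]
  refine lt_of_lt_of_le (Nat.cast_lt.mpr one_pos) (PowerSeries.nat_le_order _ 1 fun i hi ↦ ?_)
  rw [Nat.lt_one_iff.mp hi, FunLike.coe_sub,
    ModularForm.qExpansion_sub one_pos one_mem_strictPeriods_SL, map_sub, h, sub_self]

/-! ### Modularity of the Serre derivative of E₂ -/

lemma hasDerivAt_D2_comp_ofComplex (γ : SL(2, ℤ)) (z : ℍ) :
    HasDerivAt (D2 γ ∘ ofComplex) (-(2 * Real.pi * I) * (γ 1 0 / denom γ z) ^ 2) (z : ℂ) := by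
  have hz := denom_ne_zero (γ : GL (Fin 2) ℝ) z
  have hd : ∀ w : ℍ, denom γ w = γ 1 0 * w + γ 1 1 := ModularGroup.denom_apply γ
  rw [hd] at hz ⊢
  have h := ((((hasDerivAt_id (z : ℂ)).const_mul (γ 1 0 : ℂ)).add_const (γ 1 1 : ℂ)).inv
    hz).const_mul (2 * Real.pi * I * γ 1 0)
  refine (h.congr_deriv ?_).congr_of_eventuallyEq ?_
  · simp only [id_eq]
    field_simp
  · filter_upwards [isOpen_upperHalfPlaneSet.mem_nhds z.im_pos] with w hw
    rw [Function.comp_apply, ofComplex_apply_of_im_pos hw, D2, hd, div_eq_mul_inv]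
    rfl

lemma mdifferentiable_D2 (γ : SL(2, ℤ)) : MDiff (D2 γ) := fun z ↦
  UpperHalfPlane.mdifferentiableAt_iff.mpr (hasDerivAt_D2_comp_ofComplex γ z).differentiableAt

lemma normalizedDeriv_D2 (γ : SL(2, ℤ)) (z : ℍ) :
    normalizedDerivOfComplex (D2 γ) z = -(γ 1 0 / denom γ z) ^ 2 := by
  rw [normalizedDerivOfComplex, (hasDerivAt_D2_comp_ofComplex γ z).deriv]
  field_simp [two_pi_I_ne_zero]

/-- Although `E2` is not modular, its Serre derivative of weight `1` is, of weight `4`. -/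
lemma serreDerivative_E2_slash (γ : SL(2, ℤ)) :
    Derivative.serreDerivative 1 E2 ∣[(2 + 2 : ℤ)] γ = Derivative.serreDerivative 1 E2 := by
  -- The weight 2 Serre derivative commutes with slashing; the anomaly of E₂² / 12 then cancels the
  -- one it inherits from E₂.
  have hE : Derivative.serreDerivative 1 E2 =
      Derivative.serreDerivative ((2 : ℤ) : ℂ) E2 + (12⁻¹ : ℂ) • (E2 * E2) := by
    ext z
    simp
    ring
  rw [hE, SlashAction.add_slash, SL_smul_slash, ModularForm.mul_slash_SL2,
    serreDerivative_slash_equivariant E2_mdifferentiable, E2_slash_action,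
    serreDerivative_sub _ _ _ E2_mdifferentiable ((mdifferentiable_D2 γ).const_smul _),
    serreDerivative_smul _ _ _ (mdifferentiable_D2 γ)]
  ext z
  have hpi : (Real.pi : ℂ) ≠ 0 := ofReal_ne_zero.mpr Real.pi_ne_zero
  simp only [Pi.add_apply, Pi.sub_apply, Pi.smul_apply, Pi.mul_apply, smul_eq_mul,
    serreDerivative_apply, normalizedDeriv_D2, riemannZeta_two]
  simp only [D2, mul_div_assoc]
  generalize (γ 1 0 : ℂ) / denom γ z = t
  field_simp
  push_cast
  ring_nf
  simp [I_sq]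

/-! ### Ramanujan's differential equations -/

lemma qExpansion_serreDerivative {f : ℍ → ℂ} (hf : IsHolomorphicPeriodic f) (k : ℂ) :
    qExpansion 1 (Derivative.serreDerivative k f) =
      ((X : ℂ⟦X⟧) • PowerSeries.derivative ℂ) (qExpansion 1 f) -
        (k * 12⁻¹) • (qExpansion 1 E2 * qExpansion 1 f) := by
  have : Derivative.serreDerivative k f =
      normalizedDerivOfComplex f - (k * 12⁻¹) • (E2 * f) := by
    ext z; simp [mul_assoc]
  have hE := IsHolomorphicPeriodic.of_E2
  rw [this, qExpansion_sub hf.normalizedDeriv.analyticAt ((hE.mul hf).smul _).analyticAt,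
    qExpansion_smul (hE.mul hf).analyticAt, qExpansion_mul hE.analyticAt hf.analyticAt,
    hf.qExpansion_normalizedDeriv]

lemma coeff_zero_qExpansion_serreDerivative {f : ℍ → ℂ} (hf : IsHolomorphicPeriodic f) (k : ℂ) :
    (qExpansion 1 (Derivative.serreDerivative k f)).coeff 0 =
      -(k * 12⁻¹) * (qExpansion 1 f).coeff 0 := by
  rw [qExpansion_serreDerivative hf, ← hf.qExpansion_normalizedDeriv, map_sub,
    hf.coeff_qExpansion_normalizedDeriv, PowerSeries.coeff_smul, PowerSeries.coeff_mul]
  simp [-PowerSeries.coeff_zero_eq_constantCoeff, coeff_qExpansion_E2]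

lemma coeff_zero_qExpansion_smul {f : ℍ → ℂ} (hf : IsHolomorphicPeriodic f) (c : ℂ) :
    (qExpansion 1 (c • f)).coeff 0 = c * (qExpansion 1 f).coeff 0 := by
  rw [qExpansion_smul hf.analyticAt, PowerSeries.coeff_smul, smul_eq_mul]

/-- The Serre derivative of a level one modular form of weight `k`, of weight `k + 2`. -/
noncomputable def serreDerivativeForm {k : ℤ} (F : ModularForm 𝒮ℒ k) : ModularForm 𝒮ℒ (k + 2) :=
  have h := (IsHolomorphicPeriodic.of_modularForm F).serreDerivative k
  levelOneForm (k + 2) (Derivative.serreDerivative k F) h.mdifferentiable h.bounded fun γ ↦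
    serreDerivative_slash_invariant (ModularFormClass.holo F)
      (SlashInvariantForm.slash_action_eqn F _ ⟨γ, rfl⟩)

lemma serreDerivative_E2 : Derivative.serreDerivative 1 E2 = (-12⁻¹ : ℂ) • (E₄ : ℍ → ℂ) := by
  have h := IsHolomorphicPeriodic.of_E2.serreDerivative 1
  refine levelOne_eq_of_coeff_zero_eq (k := 4) (by norm_num)
    (levelOneForm 4 _ h.mdifferentiable h.bounded serreDerivative_E2_slash) ((-12⁻¹ : ℂ) • E₄)
    rfl rfl ?_
  rw [coeff_zero_qExpansion_serreDerivative .of_E2,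
    coeff_zero_qExpansion_smul (.of_modularForm E₄), coeff_qExpansion_E2,
    E_qExpansion_coeff_zero _ (by decide)]
  simp

lemma serreDerivative_E₄ : Derivative.serreDerivative 4 E₄ = (-3⁻¹ : ℂ) • (E₆ : ℍ → ℂ) := by
  refine levelOne_eq_of_coeff_zero_eq (k := 6) (by norm_num) (serreDerivativeForm E₄)
    ((-3⁻¹ : ℂ) • E₆) (by simp [serreDerivativeForm, levelOneForm]; rfl) rfl ?_
  rw [coeff_zero_qExpansion_serreDerivative (.of_modularForm E₄),
    coeff_zero_qExpansion_smul (.of_modularForm E₆), E_qExpansion_coeff_zero _ (by decide),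
    E_qExpansion_coeff_zero _ (by decide)]
  norm_num

lemma serreDerivative_E₆ :
    Derivative.serreDerivative 6 E₆ = (-2⁻¹ : ℂ) • (E₄ * E₄ : ℍ → ℂ) := by
  have h4 := IsHolomorphicPeriodic.of_modularForm E₄
  refine levelOne_eq_of_coeff_zero_eq (k := 8) (by norm_num) (serreDerivativeForm E₆)
    ((-2⁻¹ : ℂ) • E₄.mul E₄) (by simp [serreDerivativeForm, levelOneForm]; rfl) rfl ?_
  rw [coeff_zero_qExpansion_serreDerivative (.of_modularForm E₆),
    coeff_zero_qExpansion_smul (h4.mul h4), qExpansion_mul h4.analyticAt h4.analyticAt,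
    PowerSeries.coeff_mul, E_qExpansion_coeff_zero _ (by decide)]
  simp [-PowerSeries.coeff_zero_eq_constantCoeff, E_qExpansion_coeff_zero _ (show Even 4 by decide)]
  norm_num

/-! ### The algebraic identity -/

/-- The identity expressing the discriminant through iterated derivatives of Eisenstein series, in
any commutative ring with a derivation satisfying `12` times Ramanujan's differential
equations. -/
lemma ramanujan_derivation_identity {R A : Type*} [CommRing R] [CommRing A] [Algebra R A]
    (E : Derivation R A A) {e2 e4 e6 : A} (h2 : E e2 = e2 ^ 2 - e4)
    (h4 : E e4 = 4 * (e2 * e4 - e6)) (h6 : E e6 = 6 * (e2 * e6 - e4 ^ 2)) :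
    60 * E (E (E (E e4))) + 84 * E (E (E (E (E e2)))) - 420 * (e2 * E (E (E (E e2)))) =
      3456 * (e4 ^ 3 - e6 ^ 2) := by
  have hc (n : ℕ) [n.AtLeastTwo] : E (OfNat.ofNat n : A) = 0 := by
    rw [← Nat.cast_ofNat, E.map_natCast]
  have a2 : E (E e2) = 2 * e2 ^ 3 - 6 * e2 * e4 + 4 * e6 := by
    rw [h2]
    simp only [h2, h4, map_sub, E.leibniz_pow, nsmul_eq_mul, smul_eq_mul]
    push_cast
    ring
  have a3 : E (E (E e2)) = 6 * e2 ^ 4 - 36 * e2 ^ 2 * e4 + 48 * e2 * e6 - 18 * e4 ^ 2 := by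
    rw [a2]
    simp only [h2, h4, h6, hc, map_add, map_sub, E.leibniz, E.leibniz_pow, nsmul_eq_mul,
      smul_eq_mul]
    push_cast
    ring
  have a4 : E (E (E (E e2))) =
      24 * e2 ^ 5 - 240 * e2 ^ 3 * e4 + 480 * e2 ^ 2 * e6 - 360 * e2 * e4 ^ 2 + 96 * e4 * e6 := by
    rw [a3]
    simp only [h2, h4, h6, hc, map_add, map_sub, E.leibniz, E.leibniz_pow, nsmul_eq_mul,
      smul_eq_mul]
    push_cast
    ring
  have a5 : E (E (E (E (E e2)))) =
      120 * e2 ^ 6 - 1800 * e2 ^ 4 * e4 + 4800 * e2 ^ 3 * e6 - 5400 * e2 ^ 2 * e4 ^ 2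
        + 2880 * e2 * e4 * e6 - 216 * e4 ^ 3 - 384 * e6 ^ 2 := by
    rw [a4]
    simp only [h2, h4, h6, hc, map_add, map_sub, E.leibniz, E.leibniz_pow, nsmul_eq_mul,
      smul_eq_mul]
    push_cast
    ring
  have b2 : E (E e4) = 20 * e2 ^ 2 * e4 - 40 * e2 * e6 + 20 * e4 ^ 2 := by
    rw [h4]
    simp only [h2, h4, h6, hc, map_sub, E.leibniz, smul_eq_mul]
    ring
  have b3 : E (E (E e4)) =
      120 * e2 ^ 3 * e4 - 360 * e2 ^ 2 * e6 + 360 * e2 * e4 ^ 2 - 120 * e4 * e6 := by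
    rw [b2]
    simp only [h2, h4, h6, hc, map_add, map_sub, E.leibniz, E.leibniz_pow, nsmul_eq_mul,
      smul_eq_mul]
    push_cast
    ring
  have b4 : E (E (E (E e4))) =
      840 * e2 ^ 4 * e4 - 3360 * e2 ^ 3 * e6 + 5040 * e2 ^ 2 * e4 ^ 2 - 3360 * e2 * e4 * e6
        + 360 * e4 ^ 3 + 480 * e6 ^ 2 := by
    rw [b3]
    simp only [h2, h4, h6, hc, map_add, map_sub, E.leibniz, E.leibniz_pow, nsmul_eq_mul,
      smul_eq_mul]
    push_cast
    ring
  -- Only 3456 e₄³ and -3456 e₆² survive.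
  rw [a5, a4, b4]
  ring

/-! ### Transfer to power series and comparison of coefficients -/

/-- The derivation `12 * q * d / dq` of power series. -/
noncomputable def twelveTheta : Derivation ℂ ℂ⟦X⟧ ℂ⟦X⟧ :=
  (12 : ℂ) • ((X : ℂ⟦X⟧) • PowerSeries.derivative ℂ)

lemma coeff_twelveTheta (f : ℂ⟦X⟧) (m : ℕ) :
    (twelveTheta f).coeff m = 12 * m * f.coeff m := by
  simp only [twelveTheta, Derivation.smul_apply, PowerSeries.coeff_smul, smul_eq_mul]
  cases m <;> simp [coeff_succ_X_mul, coeff_derivative]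
  ring

lemma twelveTheta_qExpansion {f g : ℍ → ℂ} (hf : IsHolomorphicPeriodic f)
    (hg : IsHolomorphicPeriodic g) {k c : ℂ} (h : Derivative.serreDerivative k f = c • g) :
    twelveTheta (qExpansion 1 f) =
      k • (qExpansion 1 E2 * qExpansion 1 f) + (12 * c) • qExpansion 1 g := by
  have h1 := qExpansion_serreDerivative hf k
  rw [h, qExpansion_smul hg.analyticAt, eq_sub_iff_add_eq] at h1
  rw [twelveTheta, Derivation.smul_apply, ← h1]
  module

lemma qExpansion_discriminant :
    (1728 : ℂ) • qExpansion 1 discriminant = qExpansion 1 E₄ ^ 3 - qExpansion 1 E₆ ^ 2 := by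
  have h4 := IsHolomorphicPeriodic.of_modularForm E₄
  have h6 := IsHolomorphicPeriodic.of_modularForm E₆
  have hΔ : IsHolomorphicPeriodic discriminant :=
    ⟨SlashInvariantFormClass.periodic_comp_ofComplex CuspForm.discriminant one_mem_strictPeriods_SL,
      CuspForm.discriminant.holo', ModularFormClass.bdd_at_infty CuspForm.discriminant⟩
  have : (1728 : ℂ) • discriminant = (E₄ * (E₄ * E₄) - E₆ * E₆ : ℍ → ℂ) := by
    ext z
    simp [discriminant_eq_E₄_cube_sub_E₆_sq]
    ring
  rw [← qExpansion_smul hΔ.analyticAt, this,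
    qExpansion_sub (h4.mul (h4.mul h4)).analyticAt (h6.mul h6).analyticAt,
    qExpansion_mul h4.analyticAt (h4.mul h4).analyticAt, qExpansion_mul h4.analyticAt h4.analyticAt,
    qExpansion_mul h6.analyticAt h6.analyticAt]
  ring

lemma qExpansion_discriminant_eq_twelveTheta :
    60 * twelveTheta (twelveTheta (twelveTheta (twelveTheta (qExpansion 1 E₄)))) +
      84 * twelveTheta (twelveTheta (twelveTheta (twelveTheta (twelveTheta (qExpansion 1 E2))))) -
      420 * (twelveTheta (twelveTheta (twelveTheta (twelveTheta (qExpansion 1 E2)))) *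
        qExpansion 1 E2) = 3456 * ((1728 : ℂ) • qExpansion 1 discriminant) := by
  have h2 := IsHolomorphicPeriodic.of_E2
  have h4 := IsHolomorphicPeriodic.of_modularForm E₄
  have h6 := IsHolomorphicPeriodic.of_modularForm E₆
  rw [qExpansion_discriminant, mul_comm _ (qExpansion 1 E2)]
  apply ramanujan_derivation_identity
  · rw [twelveTheta_qExpansion h2 h4 serreDerivative_E2]
    norm_num [ofNat_smul_eq_nsmul ℂ, nsmul_eq_mul]
    ring
  · rw [twelveTheta_qExpansion h4 h6 serreDerivative_E₄]
    norm_num [ofNat_smul_eq_nsmul ℂ, nsmul_eq_mul]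
    ring
  · rw [twelveTheta_qExpansion h6 (h4.mul h4) serreDerivative_E₆,
      qExpansion_mul h4.analyticAt h4.analyticAt]
    norm_num [ofNat_smul_eq_nsmul ℂ, nsmul_eq_mul]
    ring

lemma coeff_qExpansion_E₄ {n : ℕ} (hn : n ≠ 0) :
    (qExpansion 1 E₄).coeff n = 240 * (σ 3 n : ℂ) := by
  rw [E_qExpansion_coeff _ (by decide), if_neg hn, show bernoulli 4 = -1 / 30 by decide +kernel]
  norm_num

/-- E₂ has constant term 1, so the pair (n, 0) gives the term outside the sum; (0, n) drops out
because of the factor 0⁴. -/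
lemma sum_antidiagonal_qExpansion_E2 {n : ℕ} (hn : 1 ≤ n) :
    ∑ p ∈ Finset.HasAntidiagonal.antidiagonal n,
      ((p.1 : ℂ) ^ 4 * (qExpansion 1 E2).coeff p.1) * (qExpansion 1 E2).coeff p.2 =
    576 * ∑ m ∈ Finset.Icc 1 (n - 1), (m : ℂ) ^ 4 * (σ 1 m : ℂ) * (σ 1 (n - m) : ℂ) -
      24 * (n : ℂ) ^ 4 * (σ 1 n : ℂ) := by
  have hI : Finset.Icc 1 (n - 1) = Finset.Ico 1 n := by ext; simp; lia
  rw [Finset.Nat.sum_antidiagonal_eq_sum_range_succ (fun i j ↦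
    ((i : ℂ) ^ 4 * (qExpansion 1 E2).coeff i) * (qExpansion 1 E2).coeff j), Finset.sum_range_succ,
    Finset.range_eq_Ico, Finset.sum_eq_sum_Ico_succ_bot hn, hI, Finset.mul_sum]
  have : ∀ m ∈ Finset.Ico (0 + 1) n,
      ((m : ℂ) ^ 4 * (qExpansion 1 E2).coeff m) * (qExpansion 1 E2).coeff (n - m) =
      576 * ((m : ℂ) ^ 4 * (σ 1 m : ℂ) * (σ 1 (n - m) : ℂ)) := by
    intro m hm
    have := Finset.mem_Ico.mp hm
    rw [coeff_qExpansion_E2, coeff_qExpansion_E2, if_neg (by lia), if_neg (by lia)]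
    ring
  rw [Finset.sum_congr rfl this, Nat.sub_self, coeff_qExpansion_E2 n, coeff_qExpansion_E2 0,
    if_pos rfl, if_neg (by lia)]
  push_cast
  ring

theorem corollary2p11 (n : ℕ) (hn : 1 ≤ n) :
    ramanujanTau n =
      50 * (n : ℂ) ^ 4 * (σ 3 n : ℂ) - 7 * (n : ℂ) ^ 4 * (12 * (n : ℂ) - 5) * (σ 1 n : ℂ)
        - 840 * ∑ m ∈ Finset.Icc 1 (n - 1), (m : ℂ) ^ 4 * (σ 1 m : ℂ) * (σ 1 (n - m) : ℂ) := by
  have h := congrArg (PowerSeries.coeff n) qExpansion_discriminant_eq_twelveTheta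
  have hnat (a : ℕ) [a.AtLeastTwo] (f : ℂ⟦X⟧) :
      (OfNat.ofNat a * f).coeff n = OfNat.ofNat a * f.coeff n := by
    rw [← Nat.cast_ofNat, ← nsmul_eq_mul, map_nsmul, nsmul_eq_mul, Nat.cast_ofNat]
  have hs : (twelveTheta (twelveTheta (twelveTheta (twelveTheta (qExpansion 1 E2)))) *
      qExpansion 1 E2).coeff n = 12 ^ 4 * ∑ p ∈ Finset.HasAntidiagonal.antidiagonal n,
        ((p.1 : ℂ) ^ 4 * (qExpansion 1 E2).coeff p.1) * (qExpansion 1 E2).coeff p.2 := by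
    rw [PowerSeries.coeff_mul, Finset.mul_sum]
    refine Finset.sum_congr rfl fun p _ ↦ ?_
    simp only [coeff_twelveTheta]
    ring
  rw [map_sub, map_add, hnat, hnat, hnat, hnat, hs, sum_antidiagonal_qExpansion_E2 hn,
    PowerSeries.coeff_smul, smul_eq_mul] at h
  simp only [coeff_twelveTheta, coeff_qExpansion_E₄ (show n ≠ 0 by lia), coeff_qExpansion_E2 n,
    if_neg (show n ≠ 0 by lia)] at h
  rw [ramanujanTau]
  -- Here 3456 · 1728 = 288 · 12⁴, which yields 50 = 60·240/288, 84 = 84·12·24/288, 35 = 420·24/288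
  -- and 840 = 420·576/288.
  linear_combination -h / (3456 * 1728)
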